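/- For integers $n\ge 1$ and $R\ge 1$, let $C_n([\![1,R]\!])$ be the circulant graph with vertex set $\mathbb{Z}/n\mathbb{Z}$ in which two distinct vertices $i,j$ are adjacent if and only if $i-j\equiv \pm d \pmod n$ for some integer $d$ with $1\le d\le R$. A $k$-adjacent vertex-distinguishing (AVD) edge-coloring of a graph is a map from its edges to a set of $k$ colors such that any two distinct edges sharing an endpoint have different colors and, for every edge $uv$, the set of colors of the edges incident to $u$ differs from the set of colors of the edges incident to $v$. Theorem. Let $R\ge 2$ be an even integer and let $n$ be an integer with $$n\ \ge\ (R+1)\,2^{1+\lfloor \log_2 R\rfloor}\left(R+(R+1)\,2^{\lfloor \log_2 R\rfloor}\right)-2R .$$ Then $C_n([\![1,R]\!])$ admits a $(2R+1)$-adjacent vertex-distinguishing edge-coloring. -/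

import Mathlib

namespace SimpleGraph

/-- The circulant graph `C_n(⟦1, R⟧)` on `ℤ/nℤ`: two distinct vertices are adjacent iff their
difference is, up to sign, the class of an integer `d` with `1 ≤ d ≤ R`. -/
def circulantInterval (n R : ℕ) : SimpleGraph (ZMod n) :=
  SimpleGraph.circulantGraph ((fun d : ℕ => (d : ZMod n)) '' Set.Icc 1 R)

namespace EdgeLabeling

variable {V K : Type*} {G : SimpleGraph V}

/-- The set of colors of the edges incident to the vertex `v`. -/
def incidentColors (φ : G.EdgeLabeling K) (v : V) : Set K :=
  {c | ∃ (w : V) (h : G.Adj v w), φ.get v w h = c}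

/-- An edge-coloring is proper if any two distinct edges with a common endpoint get different
colors. -/
def IsProper (φ : G.EdgeLabeling K) : Prop :=
  ∀ (v u w : V) (hu : G.Adj v u) (hw : G.Adj v w), u ≠ w → φ.get v u hu ≠ φ.get v w hw

/-- A proper edge-coloring is adjacent vertex-distinguishing if the two endpoints of every edge
have different sets of incident colors. -/
def IsAVD (φ : G.EdgeLabeling K) : Prop :=
  φ.IsProper ∧ ∀ u v : V, G.Adj u v → φ.incidentColors u ≠ φ.incidentColors v

end EdgeLabeling

/-- `G` admits a `k`-adjacent vertex-distinguishing edge-coloring, i.e. one with colors in a set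
of `k` elements (not all of which need to occur). -/
def AdmitsAVD {V : Type*} (G : SimpleGraph V) (k : ℕ) : Prop :=
  ∃ φ : G.EdgeLabeling (Fin k), φ.IsAVD

end SimpleGraph

namespace SimpleGraph

variable {V K : Type*} {G : SimpleGraph V}

/-! For each color, cut the cycle into consecutive blocks of lengths `R + 1` and `R`, and join each
vertex to its mirror image in its block. The `2 * R + 1` slots have displacements exhausting `[-R,
R]`, so if the colors at every vertex fill all slots bijectively, each edge gets exactly one color.
As `R` is even, a vertex misses only the color for which it is the center of a long block, and such
centers lie more than `R` apart (`circulantInterval_admitsAVD_of_slots`). Slots can be assigned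
consistently when `n = a * (2 * R + 1) + b * (R * (R + 1))`, which is solvable for large `n` by
coprimality. -/

/-- A family of involutions, one for each color, whose graphs partition the edges and loops of `G`
and such that the fixed points of each of them form an independent set, gives an adjacent
vertex-distinguishing edge-coloring. -/
theorem exists_isAVD_of_involutive (σ : K → V → V)
    (hinv : ∀ c v, σ c (σ c v) = v)
    (hinj : ∀ c c' v, σ c v = σ c' v → c = c')
    (hadj : ∀ u v, G.Adj u v → ∃ c, σ c u = v)
    (hmem : ∀ c v, σ c v ≠ v → G.Adj v (σ c v))
    (hfix : ∀ v, ∃ c, σ c v = v)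
    (hind : ∀ c u v, G.Adj u v → σ c u = u → σ c v ≠ v) :
    ∃ φ : G.EdgeLabeling K, φ.IsAVD := by
  choose f hf using hadj
  have hsymm : ∀ (x y : V) (H : G.Adj x y), f y x H.symm = f x y H := by
    intro x y H
    apply hinj _ _ y
    have h := hinv (f x y H) x
    rw [hf x y H] at h
    rw [hf, h]
  have hget : ∀ x y (h : G.Adj x y), (EdgeLabeling.mk f hsymm).get x y h = f x y h :=
    fun x y h => EdgeLabeling.get_mk f hsymm x y h
  refine ⟨EdgeLabeling.mk f hsymm, ?_, ?_⟩
  · intro v u w hu hw huw h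
    rw [hget, hget] at h
    apply huw
    rw [← hf v u hu, ← hf v w hw, h]
  · intro u v huv h
    obtain ⟨c, hc⟩ := hfix u
    have hcv := hind c u v huv hc
    have hv : c ∈ (EdgeLabeling.mk f hsymm).incidentColors v := by
      refine ⟨_, hmem c v hcv, ?_⟩
      rw [hget]
      exact hinj _ _ v (hf _ _ _)
    rw [← h] at hv
    obtain ⟨w, hw, hwc⟩ := hv
    rw [hget] at hwc
    have := hf u w hw
    rw [hwc, hc] at this
    exact hw.ne this

/-- The displacement of a vertex under the reflection of its block. The slots `0, …, R` are the
positions in a block of length `R + 1`, the slots `R + 1, …, 2 * R` those in a block of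
length `R`. -/
def slotShift (R p : ℕ) : ℤ :=
  if p ≤ R then R - 2 * p else 3 * R + 1 - 2 * p

theorem abs_slotShift_le {R p : ℕ} (hp : p < 2 * R + 1) : |slotShift R p| ≤ R := by
  unfold slotShift
  split_ifs <;> rw [abs_le] <;> constructor <;> omega

theorem eq_of_slotShift_eq {R p q : ℕ} (h : slotShift R p = slotShift R q) : p = q := by
  unfold slotShift at h
  split_ifs at h <;> omega

/-- Long blocks realize the displacements with the parity of `R`, short blocks the others. -/
theorem exists_slotShift_eq {R : ℕ} {d : ℤ} (hd : |d| ≤ R) :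
    ∃ p < 2 * R + 1, slotShift R p = d := by
  rw [abs_le] at hd
  unfold slotShift
  rcases Int.emod_two_eq_zero_or_one (R - d) with h | h
  · refine ⟨((R - d) / 2).toNat, by omega, ?_⟩
    rw [if_pos (by omega)]
    omega
  · refine ⟨((3 * R + 1 - d) / 2).toNat, by omega, ?_⟩
    rw [if_neg (by omega)]
    omega

theorem circulantInterval_adj_iff {n R : ℕ} (hn : R < n) {u v : ZMod n} :
    (circulantInterval n R).Adj u v ↔ ∃ d : ℤ, d ≠ 0 ∧ |d| ≤ R ∧ v = u + d := by
  simp only [circulantInterval, circulantGraph, fromRel_adj, Set.mem_image, Set.mem_Icc]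
  constructor
  · rintro ⟨-, ⟨d, hd, h⟩ | ⟨d, hd, h⟩⟩
    · refine ⟨-d, by omega, ?_, ?_⟩
      · rw [abs_neg, Nat.abs_cast]; omega
      · push_cast; rw [h]; ring
    · refine ⟨d, by omega, ?_, ?_⟩
      · rw [Nat.abs_cast]; omega
      · push_cast; rw [h]; ring
  · rintro ⟨d, hd, hdR, rfl⟩
    refine ⟨?_, ?_⟩
    · intro h
      have h0 : (d : ZMod n) = 0 := by simpa using h.symm
      rw [← Int.cast_zero, ZMod.intCast_eq_intCast_iff_dvd_sub, zero_sub, dvd_neg] at h0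
      exact hd (Int.eq_zero_of_abs_lt_dvd h0 (by omega))
    · rcases le_total 0 d with h | h
      · right
        refine ⟨d.toNat, by rw [abs_of_nonneg h] at hdR; omega, ?_⟩
        rw [← Int.cast_natCast, Int.toNat_of_nonneg h]; ring
      · left
        refine ⟨(-d).toNat, by rw [abs_of_nonpos h] at hdR; omega, ?_⟩
        rw [← Int.cast_natCast, Int.toNat_of_nonneg (by omega)]; push_cast; ring

/-- If at each vertex every slot is taken by exactly one color and each color runs through the
slots of a block in order, then reflecting the blocks gives an adjacent vertex-distinguishing
edge-coloring. -/
theorem circulantInterval_admitsAVD_of_slots {n R : ℕ} (hR : Even R) (hn : 2 * R < n)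
    (s : ZMod n → Fin (2 * R + 1) → ℕ)
    (hlt : ∀ v c, s v c < 2 * R + 1)
    (hinj : ∀ v, Function.Injective (s v))
    (hstep : ∀ v c, s v c ≠ R → s v c ≠ 2 * R → s (v + 1) c = s v c + 1) :
    (circulantInterval n R).AdmitsAVD (2 * R + 1) := by
  have hsurj : ∀ v, ∀ p < 2 * R + 1, ∃ c, s v c = p := by
    intro v p hp
    have hi : Function.Injective (fun c => (⟨s v c, hlt v c⟩ : Fin (2 * R + 1))) :=
      fun a b h => hinj v (by simpa using h)
    obtain ⟨c, hc⟩ := (Finite.injective_iff_surjective.mp hi) ⟨p, hp⟩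
    exact ⟨c, by simpa using hc⟩
  have hfwd : ∀ (t : ℕ) v c, (s v c + t ≤ R ∨ R < s v c ∧ s v c + t ≤ 2 * R) →
      s (v + t) c = s v c + t := by
    intro t
    induction t with
    | zero => simp
    | succ t ih =>
      intro v c h
      have h1 := ih v c (by omega)
      have h2 := hstep (v + t) c (by omega) (by omega)
      push_cast
      rw [← add_assoc, h2, h1]
      ring
  have hbwd : ∀ (t : ℕ) v c, (t ≤ s v c ∧ (s v c ≤ R ∨ R + 1 + t ≤ s v c)) →
      s (v - t) c = s v c - t := by
    intro t v c h
    have := hlt v c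
    -- Some color holds the target slot at `v - t`; moved forward it reaches the slot of `c` at `v`,
    -- so it is `c`.
    obtain ⟨c', hc'⟩ := hsurj (v - t) (s v c - t) (by omega)
    have h1 := hfwd t (v - t) c' (by omega)
    rw [sub_add_cancel, hc', Nat.sub_add_cancel h.1] at h1
    rw [← hc', hinj v h1]
  have hrefl : ∀ v c, slotShift R (s (v + (slotShift R (s v c) : ℤ)) c) =
      - slotShift R (s v c) := by
    intro v c
    have hl := hlt v c
    rcases le_total 0 (slotShift R (s v c)) with h | h
    · obtain ⟨t, ht⟩ := Int.eq_ofNat_of_zero_le h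
      have h1 := hfwd t v c (by unfold slotShift at ht; split_ifs at ht <;> omega)
      rw [ht, Int.cast_natCast, h1]
      unfold slotShift at ht ⊢
      split_ifs at ht ⊢ <;> omega
    · obtain ⟨t, ht⟩ := Int.eq_ofNat_of_zero_le (neg_nonneg.mpr h)
      have ht' : slotShift R (s v c) = -(t : ℤ) := by omega
      have h1 := hbwd t v c (by unfold slotShift at ht; split_ifs at ht <;> omega)
      rw [ht', Int.cast_neg, Int.cast_natCast, ← sub_eq_add_neg, h1]
      unfold slotShift at ht ⊢
      split_ifs at ht ⊢ <;> omega
  have hcast : ∀ d e : ℤ, |d| ≤ R → |e| ≤ R → (d : ZMod n) = e → d = e := by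
    intro d e hd he h
    rw [ZMod.intCast_eq_intCast_iff_dvd_sub] at h
    have := abs_sub e d
    have := Int.eq_zero_of_abs_lt_dvd h (by omega)
    omega
  obtain ⟨r, hr⟩ := hR
  have hfixed : ∀ c v, v + ((slotShift R (s v c) : ℤ) : ZMod n) = v → s v c = r := by
    intro c v h
    have h0 := hcast _ 0 (abs_slotShift_le (hlt v c)) (by simp) (by simpa using h)
    unfold slotShift at h0
    split_ifs at h0 <;> omega
  have hsep : ∀ (d : ℕ) v c, 1 ≤ d → d ≤ R → s v c = r → s (v + d) c ≠ r := by
    intro d v c hd hdR hv hvd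
    rcases le_total d r with h | h
    · have := hfwd d v c (by omega)
      omega
    -- The block centered at `v + d` starts at `v + d - r`, no later than `v + r`, where the block
    -- centered at `v` ends. So `v + r` would have both slot `R` and slot `R - d`.
    · have h1 := hbwd r (v + d) c (by omega)
      have h2 := hfwd r v c (by omega)
      have h3 := hfwd (R - d) (v + d - r) c (by omega)
      have h4 : v + d - r + ((R - d : ℕ) : ZMod n) = v + r := by
        rw [Nat.cast_sub hdR, hr]; push_cast; ring
      rw [h4] at h3
      omega
  refine exists_isAVD_of_involutive
    (fun c v => v + ((slotShift R (s v c) : ℤ) : ZMod n)) ?_ ?_ ?_ ?_ ?_ ?_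
  · intro c v
    simp only [hrefl]
    push_cast
    ring
  · intro c c' v h
    exact hinj v (eq_of_slotShift_eq (hcast _ _ (abs_slotShift_le (hlt v c))
      (abs_slotShift_le (hlt v c')) (add_left_cancel h)))
  · intro u v h
    obtain ⟨d, -, hd, rfl⟩ := (circulantInterval_adj_iff (by omega)).mp h
    obtain ⟨p, hp, rfl⟩ := exists_slotShift_eq hd
    obtain ⟨c, rfl⟩ := hsurj u p hp
    exact ⟨c, rfl⟩
  · intro c v h
    refine (circulantInterval_adj_iff (by omega)).mpr
      ⟨_, ?_, abs_slotShift_le (hlt v c), rfl⟩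
    intro h0
    simp [h0] at h
  · intro v
    obtain ⟨c, hc⟩ := hsurj v r (by omega)
    refine ⟨c, ?_⟩
    have : slotShift R r = 0 := by
      unfold slotShift
      rw [if_pos (by omega)]
      omega
    simp [hc, this]
  · intro c u v h hu hv
    obtain ⟨d, hd0, hd, rfl⟩ := (circulantInterval_adj_iff (by omega)).mp h
    have hu := hfixed c _ hu
    have hv := hfixed c _ hv
    obtain ⟨t, rfl | rfl⟩ := Int.eq_nat_or_neg d
    · rw [Nat.abs_cast] at hd
      exact hsep t u c (by omega) (by omega) hu (by simpa using hv)
    · rw [abs_neg, Nat.abs_cast] at hd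
      exact hsep t _ c (by omega) (by omega) hv (by simpa using hu)

/-- The slot of the color `c` at the vertex `v`: the first `m` vertices run through all slots in
one cycle, the later ones run through the two kinds of blocks separately. -/
def slotAt (R m v c : ℕ) : ℕ :=
  if v < m then (c + v) % (2 * R + 1)
  else if c ≤ R then (c + (v - m)) % (R + 1) else R + 1 + (c - (R + 1) + (v - m)) % R

theorem slotAt_lt {R m v c : ℕ} (hR : 0 < R) : slotAt R m v c < 2 * R + 1 := by
  unfold slotAt
  have h1 := Nat.mod_lt (c + v) (show 0 < 2 * R + 1 by omega)
  have h2 := Nat.mod_lt (c + (v - m)) (show 0 < R + 1 by omega)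
  have h3 := Nat.mod_lt (c - (R + 1) + (v - m)) hR
  split_ifs <;> omega

theorem eq_of_add_mod_eq {k a b t : ℕ} (ha : a < k) (hb : b < k)
    (h : (a + t) % k = (b + t) % k) : a = b := by
  have h' : a ≡ b [MOD k] := Nat.ModEq.add_right_cancel' t h
  exact h'.eq_of_lt_of_lt ha hb

theorem slotAt_inj {R m v c c' : ℕ} (hc : c < 2 * R + 1) (hc' : c' < 2 * R + 1)
    (h : slotAt R m v c = slotAt R m v c') : c = c' := by
  unfold slotAt at h
  have h1 := Nat.mod_lt (c + (v - m)) (show 0 < R + 1 by omega)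
  have h2 := Nat.mod_lt (c' + (v - m)) (show 0 < R + 1 by omega)
  split_ifs at h with h3 h4 h5 h5
  · exact eq_of_add_mod_eq hc hc' h
  · exact eq_of_add_mod_eq (by omega) (by omega) h
  · omega
  · omega
  · have := eq_of_add_mod_eq (k := R) (by omega) (by omega) (Nat.add_left_cancel h)
    omega

theorem add_succ_mod_eq {k a t : ℕ} (h : (a + t) % k + 1 < k) :
    (a + (t + 1)) % k = (a + t) % k + 1 := by
  rw [← add_assoc, Nat.add_mod, Nat.mod_eq_of_lt (show 1 < k by omega), Nat.mod_eq_of_lt h]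

theorem slotAt_succ {R m v c : ℕ} (hR : 0 < R) (hm : 2 * R + 1 ∣ m) (hc : c < 2 * R + 1)
    (h1 : slotAt R m v c ≠ R) (h2 : slotAt R m v c ≠ 2 * R) :
    slotAt R m (v + 1) c = slotAt R m v c + 1 := by
  have h3 := Nat.mod_lt (c + v) (show 0 < 2 * R + 1 by omega)
  have h4 := Nat.mod_lt (c + (v - m)) (show 0 < R + 1 by omega)
  have h5 := Nat.mod_lt (c - (R + 1) + (v - m)) hR
  rcases lt_trichotomy (v + 1) m with h | h | h
  · unfold slotAt at h1 h2 ⊢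
    rw [if_pos (by omega)] at h1 h2
    rw [if_pos h, if_pos (by omega)]
    exact add_succ_mod_eq (by omega)
  -- At the seam both regimes put color `c` in slot `c`, because `2 * R + 1` divides `m`.
  · have hs : slotAt R m (v + 1) c = c := by
      unfold slotAt
      rw [if_neg (by omega), h, Nat.sub_self, add_zero, add_zero]
      split_ifs with hcR
      · exact Nat.mod_eq_of_lt (by omega)
      · rw [Nat.mod_eq_of_lt (by omega)]; omega
    rw [hs]
    unfold slotAt at h1 h2 ⊢
    rw [if_pos (by omega)] at h1 h2 ⊢
    rw [← add_succ_mod_eq (by omega), h]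
    obtain ⟨a, rfl⟩ := hm
    rw [Nat.add_mul_mod_self_left, Nat.mod_eq_of_lt hc]
  · unfold slotAt at h1 h2 ⊢
    have hvm : ¬ v < m := by omega
    rw [if_neg hvm] at h1 h2 ⊢
    rw [if_neg (by omega), show v + 1 - m = v - m + 1 by omega]
    by_cases hcR : c ≤ R
    · rw [if_pos hcR] at h1 h2
      rw [if_pos hcR, if_pos hcR]
      exact add_succ_mod_eq (by omega)
    · rw [if_neg hcR] at h1 h2
      rw [if_neg hcR, if_neg hcR, add_succ_mod_eq (by omega)]
      ring

/-- Closes the assignment up around the cycle: `k` is a multiple of both block lengths. -/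
theorem slotAt_period {R m k c : ℕ} (hk : R * (R + 1) ∣ k)
    (hc : c < 2 * R + 1) : slotAt R m (m + k) c = slotAt R m 0 c := by
  obtain ⟨b, rfl⟩ := hk
  have h0 : slotAt R m 0 c = c := by
    unfold slotAt
    split_ifs
    · exact Nat.mod_eq_of_lt (by omega)
    · rw [Nat.zero_sub, add_zero, Nat.mod_eq_of_lt (by omega)]
    · rw [Nat.zero_sub, add_zero, Nat.mod_eq_of_lt (by omega)]; omega
  rw [h0]
  unfold slotAt
  rw [if_neg (by omega), Nat.add_sub_cancel_left]
  split_ifs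
  · rw [mul_comm R, mul_assoc, Nat.add_mul_mod_self_left, Nat.mod_eq_of_lt (by omega)]
  · rw [mul_assoc, Nat.add_mul_mod_self_left, Nat.mod_eq_of_lt (by omega)]; omega

theorem circulantInterval_admitsAVD_of_eq {n R a b : ℕ} (hR : 0 < R) (hReven : Even R)
    (hn : 2 * R < n) (hab : a * (2 * R + 1) + b * (R * (R + 1)) = n) :
    (circulantInterval n R).AdmitsAVD (2 * R + 1) := by
  have : NeZero n := ⟨by omega⟩
  have hm : 2 * R + 1 ∣ a * (2 * R + 1) := Dvd.intro_left _ rfl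
  refine circulantInterval_admitsAVD_of_slots hReven hn
    (fun v c => slotAt R (a * (2 * R + 1)) v.val c) (fun v c => slotAt_lt hR)
    (fun v c c' h => Fin.ext (slotAt_inj c.2 c'.2 h)) ?_
  intro v c h1 h2
  refine Eq.trans ?_ (slotAt_succ hR hm c.2 h1 h2)
  have hone : (1 : ZMod n).val = 1 := ZMod.val_one'' (by omega)
  have hv := ZMod.val_lt v
  rcases Nat.lt_or_ge (v.val + 1) n with h | h
  · rw [ZMod.val_add_of_lt (by omega), hone]
  · have hvn : v.val + 1 = n := by omega
    have hp := slotAt_period (m := a * (2 * R + 1)) (Dvd.intro_left b rfl : R * (R + 1) ∣ b * (R * (R + 1))) c.2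
    rw [hab] at hp
    rw [ZMod.val_add, hone, hvn, Nat.mod_self, hp]

end SimpleGraph

theorem theorem2 (R n : ℕ) (hR : 0 < R) (hReven : Even R)
    (hn : (R + 1) * 2 ^ (1 + Nat.log 2 R) * (R + (R + 1) * 2 ^ Nat.log 2 R) ≤ n + 2 * R) :
    (SimpleGraph.circulantInterval n R).AdmitsAVD (2 * R + 1) := by
  have hP : R + 1 ≤ 2 ^ (1 + Nat.log 2 R) := by
    rw [add_comm 1]
    exact Nat.lt_pow_succ_log_self (by norm_num) R
  -- Enough for both the Frobenius bound `2 * R * (R * (R + 1) - 1) ≤ n` and `2 * R < n`.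
  have hbound : 2 * R * (R * (R + 1)) + 2 * R + 2 * R + 1 ≤ n + 2 * R := by
    refine le_trans ?_ hn
    rw [pow_add] at hP ⊢
    generalize 2 ^ Nat.log 2 R = P at hP ⊢
    have h1 : (R + 1) * (R + 1) ≤ (R + 1) * (2 ^ 1 * P) := Nat.mul_le_mul_left _ hP
    have h2 : 2 * R + 1 ≤ R + (R + 1) * P := by nlinarith
    calc 2 * R * (R * (R + 1)) + 2 * R + 2 * R + 1
        ≤ (R + 1) * (R + 1) * (2 * R + 1) := by nlinarith
      _ ≤ _ := Nat.mul_le_mul h1 h2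
  have hcop : (2 * R + 1).gcd (R * (R + 1)) = 1 := by
    have h1 : Nat.Coprime (2 * R + 1) R := by simp
    have h2 : Nat.Coprime (2 * R + 1) (R + 1) := by
      rw [show 2 * R + 1 = R + (R + 1) by ring]
      simp
    exact Nat.Coprime.mul_right h1 h2
  obtain ⟨a, b, hab⟩ := Nat.exists_add_mul_eq_of_gcd_dvd_of_mul_pred_le (2 * R + 1)
    (R * (R + 1)) n (by simp [hcop]) (by
      have := Nat.mul_le_mul_left (2 * R) (Nat.pred_le (R * (R + 1)))
      simp only [Nat.pred_eq_sub_one, Nat.add_sub_cancel] at *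
      omega)
  exact SimpleGraph.circulantInterval_admitsAVD_of_eq hR hReven (by omega) hab
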